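/- **Setting.** A two-dimensional Lévy-type process is a conservative Feller process $\{F_t\}_{t\ge0}$ on $\mathbb{R}^2$ whose Feller generator $\mathcal{A}$ has $C_c^\infty(\mathbb{R}^2)$ in its domain and acts there as $\mathcal{A}f(x)=-\int_{\mathbb{R}^2}q(x,\xi)e^{i\langle\xi,x\rangle}\hat f(\xi)\,d\xi$, $\hat f(\xi)=(2\pi)^{-2}\int_{\mathbb{R}^2} e^{-i\langle\xi,x\rangle}f(x)\,dx$, where the symbol $q$ has for each $x$ a Lévy–Khintchine representation with triplet $(b(x),C(x),\nu(x,dy))$ and satisfies $\sup_x|q(x,\xi)|\le K(1+|\xi|^2)$ for some finite $K$ and all $\xi$, and $q(x,0)=0$ for all $x$. **Theorem.** Let $\{F_t\}_{t\ge0}$ be a two-dimensional Lévy-type process with symbol $q(x,\xi)$ and Lévy triplet $(0,c(x)I,\nu(x,dy))$, that is, $$q(x,\xi)=\tfrac12c(x)|\xi|^2+\int_{\mathbb{R}^2}\bigl(1-e^{i\langle\xi,y\rangle}+i\langle\xi,y\rangle 1_{B_1(0)}(y)\bigr)\,\nu(x,dy),$$ and assume that $\xi\mapsto q(x,\xi)$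 is radial (invariant under all rotations of the plane) for every $x\in\mathbb{R}^2$. Assume that there is $u_0>1$ such that for every $x\in\mathbb{R}^2$ the measure $\nu(x,du\times\mathbb{R})$ on $\mathbb{R}$ is quasi-unimodal with respect to $u_0$, that is, it is symmetric and $u\mapsto\nu(x,(u,\infty)\times\mathbb{R})$ is convex on $(u_0,\infty)$. Put $N(x,u):=\nu(x,(u,\infty)\times\mathbb{R})$ for $u\ge0$. With the convention $1/0=\infty$, $$\int_{B_r(0)}\frac{d\xi}{\sup_{x\in\mathbb{R}^2}|q(x,\xi)|}=\infty\quad\text{for some }r>0$$ if, and only if, $$\int_r^\infty\Bigl(\rho\,\sup_{x\in\mathbb{R}^2}\int_0^\rho uN(x,u)\,du\Bigr)^{-1}d\rho=\infty\quad\text{for some }r>0.$$ If, in addition, $$\liminf_{|\xi|\to0}\ \inf_{x\in\mathbb{R}^2}\int_{\mathbb{R}^2}\frac{1-\cos\langle\xi,y\rangle}{|\xi|^2}\,\nu(x,dy)=\infty,$$ then $$\int_{B_r(0)}\frac{d\xi}{\inf_{x\in\mathbb{R}^2}\operatorname{Re}q(x,\xi)}<\infty\quad\text{for some }r>0$$ if,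 and only if, $$\int_r^\infty\Bigl(\rho\,\inf_{x\in\mathbb{R}^2}\int_0^\rho uN(x,u)\,du\Bigr)^{-1}d\rho<\infty\quad\text{for some }r>0.$$ -/

import Mathlib

open MeasureTheory ProbabilityTheory Set Filter Topology Metric Complex Matrix
open scoped NNReal ENNReal ContDiff ZeroAtInfty InnerProductSpace

/-- The Euclidean space `ℝ^d`. -/
abbrev Euc (d : ℕ) : Type := EuclideanSpace ℝ (Fin d)

/-- A (conservative) Markov process with state space `ℝ^d`: a sample space with probability
measures `ℙ^x`, a filtration, shift operators and an adapted family of random variables, such that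
`ℙ^x`-almost surely the process starts in `x` and
`ℙ^x(M_{t+s} ∈ B | ℱ_t) = ℙ^{M_t}(M_s ∈ B)`. -/
structure MarkovProcess (d : ℕ) (Ω : Type*) [mΩ : MeasurableSpace Ω] where
  law : Euc d → Measure Ω
  filtration : Filtration ℝ≥0 mΩ
  shift : ℝ≥0 → Ω → Ω
  path : ℝ≥0 → Ω → Euc d
  isProbabilityMeasure_law : ∀ x, IsProbabilityMeasure (law x)
  adapted : ∀ t, Measurable[filtration t] (path t)
  measurable_transition : ∀ t (B : Set (Euc d)), MeasurableSet B →
    Measurable fun x => law x (path t ⁻¹' B)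
  path_zero : ∀ x, ∀ᵐ w ∂(law x), path 0 w = x
  path_shift : ∀ s t w, path s (shift t w) = path (t + s) w
  markov : ∀ x s t (B : Set (Euc d)), MeasurableSet B →
    (law x)[(path (t + s) ⁻¹' B).indicator (fun _ => (1 : ℝ)) | filtration t]
      =ᵐ[law x] fun w => (law (path t w)).real (path s ⁻¹' B)

namespace MarkovProcess

variable {d : ℕ} {Ω : Type*} [MeasurableSpace Ω]

/-- The semigroup `P_t f(x) = 𝔼^x[f(M_t)]`. -/
noncomputable def semigroup (M : MarkovProcess d Ω) (t : ℝ≥0) (f : Euc d → ℝ) (x : Euc d) : ℝ :=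
  ∫ w, f (M.path t w) ∂(M.law x)

/-- `M` is a Feller process: the semigroup maps `C_∞(ℝ^d)` (continuous functions vanishing at
infinity) into itself and is strongly continuous there with respect to the supremum norm. -/
structure IsFeller (M : MarkovProcess d Ω) : Prop where
  map_zeroAtInfty : ∀ (t : ℝ≥0) (f : C₀(Euc d, ℝ)), ∃ g : C₀(Euc d, ℝ),
    ∀ x, g x = M.semigroup t f x
  stronglyContinuous : ∀ f : C₀(Euc d, ℝ),
    TendstoUniformly (fun (t : ℝ≥0) x => M.semigroup t f x) f (𝓝[>] 0)

/-- `f` lies in the domain of the infinitesimal generator and `g` is its image: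
`(P_t f - f) / t → g` in supremum norm as `t ↓ 0`. -/
def HasGenerator (M : MarkovProcess d Ω) (f g : Euc d → ℝ) : Prop :=
  TendstoUniformly (fun (t : ℝ≥0) x => (M.semigroup t f x - f x) / (t : ℝ)) g (𝓝[>] 0)

end MarkovProcess

/-- `f ∈ C_c^∞(ℝ^d)`. -/
def IsTestFunction {d : ℕ} (f : Euc d → ℝ) : Prop :=
  ContDiff ℝ ∞ f ∧ HasCompactSupport f

/-- The Fourier transform `(2π)^{-d} ∫ e^{-i⟨ξ,x⟩} f(x) dx`. -/
noncomputable def fourierHat {d : ℕ} (f : Euc d → ℝ) (ξ : Euc d) : ℂ :=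
  ((2 * Real.pi : ℝ) : ℂ)⁻¹ ^ d * ∫ x : Euc d, exp (-(I * (⟪ξ, x⟫_ℝ : ℝ))) * (f x : ℂ)

/-- `(b(x), C(x), ν(x,dy))` is an `x`-dependent Lévy triplet. -/
structure IsLevyTriplet {d : ℕ} (b : Euc d → Euc d) (C : Euc d → Matrix (Fin d) (Fin d) ℝ)
    (ν : Kernel (Euc d) (Euc d)) : Prop where
  measurable_drift : Measurable b
  measurable_diffusion : ∀ i j, Measurable fun x => C x i j
  posSemidef : ∀ x, (C x).PosSemidef
  no_mass_zero : ∀ x, ν x {0} = 0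
  integrable : ∀ x, ∫⁻ y, ENNReal.ofReal (min 1 (‖y‖ ^ 2)) ∂(ν x) < ⊤

/-- The function `q(x,ξ)` with the Lévy–Khintchine representation of triplet
`(b(x), C(x), ν(x,dy))`. -/
noncomputable def levySymbol {d : ℕ} (b : Euc d → Euc d)
    (C : Euc d → Matrix (Fin d) (Fin d) ℝ) (ν : Kernel (Euc d) (Euc d)) (x ξ : Euc d) : ℂ :=
  -(I * (⟪ξ, b x⟫_ℝ : ℝ)) + (1 / 2 : ℂ) * ((ξ.ofLp ⬝ᵥ (C x *ᵥ ξ.ofLp) : ℝ) : ℂ)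
    + ∫ y, (1 - exp (I * (⟪ξ, y⟫_ℝ : ℝ))
        + I * (⟪ξ, y⟫_ℝ : ℝ) * (ball (0 : Euc d) 1).indicator (fun _ => (1 : ℂ)) y) ∂(ν x)

/-- `F` is a Lévy-type process with Lévy triplet `(b(x), C(x), ν(x,dy))`, that is, with symbol
`q = levySymbol b C ν`: a Feller process whose generator has `C_c^∞(ℝ^d)` in its domain and acts
there as the pseudo-differential operator with symbol `q`, where
`sup_x |q(x,ξ)| ≤ K (1 + |ξ|²)` and `q(x,0) = 0`. -/
structure IsLevyTypeProcess {d : ℕ} {Ω : Type*} [MeasurableSpace Ω] (F : MarkovProcess d Ω)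
    (b : Euc d → Euc d) (C : Euc d → Matrix (Fin d) (Fin d) ℝ)
    (ν : Kernel (Euc d) (Euc d)) : Prop where
  feller : F.IsFeller
  triplet : IsLevyTriplet b C ν
  test_mem_domain : ∀ f : Euc d → ℝ, IsTestFunction f → ∃ g : Euc d → ℝ, F.HasGenerator f g
  generator_eq : ∀ f g : Euc d → ℝ, IsTestFunction f → F.HasGenerator f g →
    ∀ x, (g x : ℂ) = -∫ ξ : Euc d,
      levySymbol b C ν x ξ * exp (I * (⟪ξ, x⟫_ℝ : ℝ)) * fourierHat f ξ
  bounded : ∃ K : ℝ, ∀ x ξ, ‖levySymbol b C ν x ξ‖ ≤ K * (1 + ‖ξ‖ ^ 2)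
  symbol_zero : ∀ x, levySymbol b C ν x 0 = 0

/-- The rotation of the plane for the angle `φ`. -/
noncomputable def planeRotation (φ : ℝ) (y : Euc 2) : Euc 2 :=
  !₂[Real.cos φ * y 0 - Real.sin φ * y 1, Real.sin φ * y 0 + Real.cos φ * y 1]

/-- A function on the plane is radial if it is invariant under all rotations. -/
def IsRadial (f : Euc 2 → ℂ) : Prop :=
  ∀ y, ∀ φ ∈ Ico 0 (2 * Real.pi), f (planeRotation φ y) = f y

/-- A symmetric Borel measure `μ` on `ℝ` is quasi-unimodal with respect to `u₀` if
`u ↦ μ(u,∞)` is a (finite) convex function on `(u₀,∞)`. -/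
structure IsQuasiUnimodal (μ : Measure ℝ) (u₀ : ℝ) : Prop where
  symmetric : μ.map (fun u => -u) = μ
  tail_finite : ∀ u, u₀ < u → μ (Ioi u) < ⊤
  tail_convex : ConvexOn ℝ (Ioi u₀) fun u => (μ (Ioi u)).toReal

/-- The measure `ν(x, du × ℝ)`. -/
noncomputable def firstMarginal (ν : Kernel (Euc 2) (Euc 2)) (x : Euc 2) : Measure ℝ :=
  (ν x).map fun y => y 0

/-- `N(x,u) = ν(x, (u,∞) × ℝ)`. -/
noncomputable def tailN (ν : Kernel (Euc 2) (Euc 2)) (x : Euc 2) (u : ℝ) : ℝ≥0∞ :=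
  ν x {y | u < y 0}

/-- `∫_0^ρ u N(x,u) du`. -/
noncomputable def truncN (ν : Kernel (Euc 2) (Euc 2)) (x : Euc 2) (ρ : ℝ) : ℝ≥0∞ :=
  ∫⁻ u in Ioc 0 ρ, ENNReal.ofReal u * tailN ν x u

/-- The Chung–Fuchs type recurrence condition `∫_{B_r(0)} dξ / sup_x |q(x,ξ)| = ∞` for some
`r > 0` (with `1/0 = ∞`). -/
def ChungFuchsRecurrence {d : ℕ} (q : Euc d → Euc d → ℂ) : Prop :=
  ∃ r : ℝ, 0 < r ∧ ∫⁻ ξ in ball (0 : Euc d) r, (⨆ x, ‖q x ξ‖ₑ)⁻¹ = ⊤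

/-- The Chung–Fuchs type transience condition `∫_{B_r(0)} dξ / inf_x Re q(x,ξ) < ∞` for some
`r > 0` (with `1/0 = ∞`). -/
def ChungFuchsTransience {d : ℕ} (q : Euc d → Euc d → ℂ) : Prop :=
  ∃ r : ℝ, 0 < r ∧ ∫⁻ ξ in ball (0 : Euc d) r, (⨅ x, ENNReal.ofReal (q x ξ).re)⁻¹ < ⊤

/-- `∫_r^∞ (ρ sup_x ∫_0^ρ u N(x,u) du)^{-1} dρ = ∞` for some `r > 0` (with `1/0 = ∞`). -/
def TailDivergence (ν : Kernel (Euc 2) (Euc 2)) : Prop :=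
  ∃ r : ℝ, 0 < r ∧ ∫⁻ ρ in Ioi r, (ENNReal.ofReal ρ * ⨆ x, truncN ν x ρ)⁻¹ = ⊤

/-- `∫_r^∞ (ρ inf_x ∫_0^ρ u N(x,u) du)^{-1} dρ < ∞` for some `r > 0` (with `1/0 = ∞`). -/
def TailConvergence (ν : Kernel (Euc 2) (Euc 2)) : Prop :=
  ∃ r : ℝ, 0 < r ∧ ∫⁻ ρ in Ioi r, (ENNReal.ofReal ρ * ⨅ x, truncN ν x ρ)⁻¹ < ⊤

/-- `liminf_{|ξ|→0} inf_x ∫ (1 - cos⟨ξ,y⟩) / |ξ|² ν(x,dy) = ∞`. -/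
def UniformSecondMomentBlowup (ν : Kernel (Euc 2) (Euc 2)) : Prop :=
  liminf (fun ξ : Euc 2 =>
    ⨅ x, ∫⁻ y, ENNReal.ofReal ((1 - Real.cos ⟪ξ, y⟫_ℝ) / ‖ξ‖ ^ 2) ∂(ν x)) (𝓝[≠] 0) = ⊤

/-!
Rotating `ξ` onto the first axis turns the real part of the radial symbol into a function of
`s = ‖ξ‖`, namely `c(x) s² / 2 + ∫ (1 - cos (s u)) μ_x(du)`, where `μ_x` is the first marginal of
`ν(x, ·)`; the imaginary part vanishes because the rotation by `π` conjugates the symbol. By the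
layer cake formula, `T_x(ρ) = ∫_0^ρ u N(x,u) du` is half the second moment of `μ_x` on the positive
half-line, truncated at `ρ`. The proof is the two-sided comparison of the symbol with
`s² T_x(1/s)`, with constants that do not depend on `x`.

The upper bound `cosIntegral_le` follows from `1 - cos t ≤ min 2 (t² / 2)`. For the lower bound
`integratedTail_le` the part of `T_x(1/s)` with `u ≤ 1/s` is controlled by `1 - cos t ≥ t² / 6` on
`[0,1]`, and the remaining `N(x,1/s)` by `tail_le_cosIntegral`: when `1/s > u₀`, convexity of the
tail means that every interval on which `cos (s u)` may exceed `cos 1` has at most the mass of the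
longer interval before it, on which `1 - cos (s u) ≥ 1 - cos 1`. The diffusion coefficient, bounded
because `q(x,ξ)` is bounded uniformly in `x` for fixed `ξ`, is absorbed as soon as `T_x(ρ)` is bounded
below for large `ρ`: for the supremum over `x` this holds unless there are no jumps at all, in which
case both integrals diverge; for the infimum it is the content of the blow-up hypothesis.

Polar coordinates and `ρ = 1/s` then identify the two integrals up to constants
(`lintegral_ball_eq_lintegral_Ioi`). For the recurrence criterion it must be excluded that either
integral diverges away from the origin or from infinity. For the integral of the symbol this is the
inequality `radialProfile_le`, a consequence of the subadditivity of the square root of the symbol;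
for the tail integral it is the fact that `T_x` vanishes identically if it vanishes anywhere on
`(0,∞)`. The suprema and infima over `x` of the symbol are never integrated as measurable functions:
only the monotone function of `ρ` has to be measurable.
-/

/-! ### The cosine integral and the truncated second moment of a measure on the line -/

/-- The real part `∫ (1 - cos (s u)) μ(du)` of the jump part of the characteristic exponent
of a measure `μ` on `ℝ`. -/
noncomputable def cosIntegral (μ : Measure ℝ) (s : ℝ) : ℝ≥0∞ :=
  ∫⁻ u, ENNReal.ofReal (1 - Real.cos (s * u)) ∂μ

/-- The integrated tail `∫_0^ρ u μ(u,∞) du`. -/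
noncomputable def integratedTail (μ : Measure ℝ) (ρ : ℝ) : ℝ≥0∞ :=
  ∫⁻ u in Ioc 0 ρ, ENNReal.ofReal u * μ (Ioi u)

lemma integratedTail_mono (μ : Measure ℝ) : Monotone (integratedTail μ) := fun _ _ h =>
  lintegral_mono_set (Ioc_subset_Ioc_right h)

/-- Layer cake formula: the integrated tail is half the truncated second moment of the
restriction of `μ` to the positive half-line. -/
lemma integratedTail_eq_lintegral (μ : Measure ℝ) {ρ : ℝ} (hρ : 0 ≤ ρ) :
    integratedTail μ ρ = ∫⁻ u, ENNReal.ofReal (min (max u 0) ρ ^ 2 / 2) ∂μ := by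
  have h := lintegral_comp_eq_lintegral_meas_lt_mul μ (f := fun u => min (max u 0) ρ)
    (g := fun t => t) (ae_of_all _ fun u => le_min (le_max_right _ _) hρ)
    (by fun_prop) (fun t _ => intervalIntegral.intervalIntegrable_id)
    (by filter_upwards [ae_restrict_mem measurableSet_Ioi] with t ht using le_of_lt ht)
  simp only [integral_id] at h
  rw [integratedTail, Measure.restrict_congr_set Ioo_ae_eq_Ioc.symm,
    ← lintegral_indicator measurableSet_Ioo]
  simp only [ne_eq, OfNat.ofNat_ne_zero, not_false_eq_true, zero_pow, sub_zero] at h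
  rw [h, ← lintegral_indicator measurableSet_Ioi]
  refine lintegral_congr fun t => ?_
  by_cases h0 : 0 < t
  · by_cases h1 : t < ρ
    · have : {a : ℝ | t < min (max a 0) ρ} = Ioi t := by
        ext a; simp [h1, not_lt.2 h0.le]
      rw [indicator_of_mem (show t ∈ Ioo 0 ρ from ⟨h0, h1⟩), indicator_of_mem (mem_Ioi.2 h0), this,
        mul_comm]
    · simp [h0, h1]
  · simp [h0]

/-- The integrated tail vanishes at one positive radius only if it vanishes identically. -/
lemma integratedTail_eq_zero {μ : Measure ℝ} {r : ℝ} (hr : 0 < r)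
    (h : integratedTail μ r = 0) (ρ : ℝ) : integratedTail μ ρ = 0 := by
  have key : μ (Ioi 0) = 0 := by
    rw [integratedTail_eq_lintegral μ hr.le, lintegral_eq_zero_iff (by fun_prop)] at h
    refine measure_mono_null ?_ (ae_iff.1 h)
    intro u (hu : 0 < u)
    simp only [Pi.zero_apply, ENNReal.ofReal_eq_zero, not_le, mem_ofPred_eq]
    have : 0 < min (max u 0) r := lt_min (lt_max_of_lt_left hu) hr
    positivity
  unfold integratedTail
  rw [setLIntegral_congr_fun measurableSet_Ioc (g := 0)]
  · simp
  · intro u hu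
    simp [measure_mono_null (Ioi_subset_Ioi hu.1.le) key]

lemma measurable_cosIntegrand (s : ℝ) :
    Measurable fun u : ℝ => ENNReal.ofReal (1 - Real.cos (s * u)) := by fun_prop

/-- For a symmetric measure, the elementary bound `1 - cos t ≤ min 2 (t ^ 2 / 2)` controls the
cosine integral at frequency `s` by the integrated tail at radius `1 / s`. -/
lemma cosIntegral_le {μ : Measure ℝ} (hμ : μ.map (fun u => -u) = μ) {s : ℝ} (hs : 0 < s) :
    cosIntegral μ s ≤ ENNReal.ofReal (s ^ 2) * (8 * integratedTail μ (1 / s)) := by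
  have hs' : 0 ≤ 1 / s := by positivity
  set T := fun u : ℝ => ENNReal.ofReal (min (max u 0) (1 / s) ^ 2 / 2) with hT
  have hTm : Measurable T := by fun_prop
  have hsym : ∫⁻ u, T (-u) ∂μ = ∫⁻ u, T u ∂μ := by
    conv_rhs => rw [← hμ]
    rw [lintegral_map hTm measurable_neg]
  have hpt : ∀ u : ℝ, 0 ≤ u →
      1 - Real.cos (s * u) ≤ 4 * s ^ 2 * (min (max u 0) (1 / s) ^ 2 / 2) := by
    intro u hu
    rw [max_eq_left hu]
    rcases le_total u (1 / s) with h | h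
    · rw [min_eq_left h]
      have := Real.one_sub_sq_div_two_le_cos (x := s * u)
      nlinarith [sq_nonneg (s * u)]
    · rw [min_eq_right h]
      have : 4 * s ^ 2 * ((1 / s) ^ 2 / 2) = 2 := by field_simp; norm_num
      linarith [Real.neg_one_le_cos (s * u)]
  have hpt' : ∀ u : ℝ, ENNReal.ofReal (1 - Real.cos (s * u)) ≤
      ENNReal.ofReal (4 * s ^ 2) * (T u + T (-u)) := by
    intro u
    rcases le_total 0 u with h | h
    · refine (ENNReal.ofReal_le_ofReal (hpt u h)).trans ?_
      rw [ENNReal.ofReal_mul (by positivity)]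
      gcongr
      exact le_self_add
    · have := hpt (-u) (by linarith)
      rw [mul_neg, Real.cos_neg] at this
      refine (ENNReal.ofReal_le_ofReal this).trans ?_
      rw [ENNReal.ofReal_mul (by positivity)]
      gcongr
      exact le_add_self
  calc cosIntegral μ s ≤ ∫⁻ u, ENNReal.ofReal (4 * s ^ 2) * (T u + T (-u)) ∂μ :=
        lintegral_mono hpt'
    _ = ENNReal.ofReal (4 * s ^ 2) * (2 * integratedTail μ (1 / s)) := by
        rw [lintegral_const_mul' _ _ ENNReal.ofReal_ne_top, lintegral_add_left hTm, hsym,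
          integratedTail_eq_lintegral μ hs', two_mul]
    _ = _ := by
        rw [mul_comm (4 : ℝ), ENNReal.ofReal_mul (by positivity), mul_assoc, ← mul_assoc _ 2]
        norm_num

/-- If the tail is convex, an interval carries at most the mass of a longer adjacent interval
to its left. -/
lemma measure_Ioc_le_of_convex_tail {μ : Measure ℝ} {u₀ a b d : ℝ}
    (hμ : IsQuasiUnimodal μ u₀) (ha : u₀ < a) (hab : a < b) (hbd : b < d) (h : d - b ≤ b - a) :
    μ (Ioc b d) ≤ μ (Ioc a b) := by
  have hfin : ∀ u, u₀ < u → μ (Ioi u) ≠ ⊤ := fun u hu => (hμ.tail_finite u hu).ne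
  have hIoc : ∀ {v w : ℝ}, u₀ < v → v < w →
      μ (Ioc v w) = ENNReal.ofReal ((μ (Ioi v)).toReal - (μ (Ioi w)).toReal) := by
    intro v w hv hvw
    have h1 : Ioc v w = Ioi v \ Ioi w := by ext; simp
    rw [h1, measure_sdiff (Ioi_subset_Ioi hvw.le) measurableSet_Ioi.nullMeasurableSet
      (hfin w (hv.trans hvw)), ENNReal.ofReal_sub _ ENNReal.toReal_nonneg,
      ENNReal.ofReal_toReal (hfin v hv), ENNReal.ofReal_toReal (hfin w (hv.trans hvw))]
  rw [hIoc (ha.trans hab) hbd, hIoc ha hab]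
  refine ENNReal.ofReal_le_ofReal ?_
  have hslope := hμ.tail_convex.slope_mono_adjacent (mem_Ioi.2 ha)
    (mem_Ioi.2 (ha.trans (hab.trans hbd))) hab hbd
  have hanti : (μ (Ioi d)).toReal ≤ (μ (Ioi b)).toReal :=
    ENNReal.toReal_mono (hfin b (ha.trans hab)) (measure_mono (Ioi_subset_Ioi hbd.le))
  rw [div_le_div_iff₀ (by linarith) (by linarith)] at hslope
  have hba : 0 < b - a := by linarith
  nlinarith [mul_le_mul_of_nonneg_left h (sub_nonneg.2 hanti)]

lemma one_sub_cos_one_le {k : ℕ} {t : ℝ} (h1 : 1 + 2 * Real.pi * k ≤ t)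
    (h2 : t ≤ 2 * Real.pi - 1 + 2 * Real.pi * k) : 1 - Real.cos 1 ≤ 1 - Real.cos t := by
  have h : Real.cos t = Real.cos (t - k * (2 * Real.pi)) := (Real.cos_sub_nat_mul_two_pi t k).symm
  rw [h]
  set v := t - k * (2 * Real.pi)
  have hv1 : 1 ≤ v := by simp only [v]; linarith
  have hv2 : v ≤ 2 * Real.pi - 1 := by simp only [v]; linarith
  have hpi := Real.pi_gt_three
  rcases le_total v Real.pi with hv | hv
  · linarith [Real.cos_le_cos_of_nonneg_of_le_pi zero_le_one hv hv1]
  · have := Real.cos_le_cos_of_nonneg_of_le_pi zero_le_one (y := 2 * Real.pi - v)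
      (by linarith) (by linarith)
    rw [Real.cos_two_pi_sub] at this
    linarith

/-- A convex tail spreads its mass over the periods of the cosine: beyond `1 / s` each interval on
which `cos (s u)` is close to `1` is preceded by a longer interval, carrying at least the same mass,
on which `cos (s u) ≤ cos 1`. -/
lemma tail_le_cosIntegral {μ : Measure ℝ} {u₀ s : ℝ} (hμ : IsQuasiUnimodal μ u₀) (hs : 0 < s)
    (hsu : u₀ < 1 / s) :
    ENNReal.ofReal (1 - Real.cos 1) * μ (Ioi (1 / s)) ≤ 2 * cosIntegral μ s := by
  have hpi := Real.pi_gt_three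
  set κ := ENNReal.ofReal (1 - Real.cos 1)
  set a : ℕ → ℝ := fun k => (1 + 2 * Real.pi * k) / s with ha
  set b : ℕ → ℝ := fun k => (2 * Real.pi - 1 + 2 * Real.pi * k) / s with hb
  have hmono : Monotone a := by
    intro m n hmn
    simp only [ha]
    gcongr
  have hab : ∀ k, a k < b k := by
    intro k
    simp only [ha, hb]
    gcongr
    linarith
  have hba : ∀ k, b k < a (k + 1) := by
    intro k
    simp only [ha, hb]
    push_cast
    rw [div_lt_div_iff_of_pos_right hs]
    linarith
  have hunion : ⋃ k, Ioc (a k) (a (k + 1)) = Ioi (1 / s) := by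
    have := iUnion_Ioc_map_succ_eq_Ioi (f := a) (fun k => hmono (Nat.zero_le k)) (by
      rw [not_bddAbove_iff]
      intro x
      obtain ⟨n, hn⟩ := exists_nat_gt (x * s)
      refine ⟨a n, mem_range_self n, ?_⟩
      simp only [ha]
      rw [lt_div_iff₀ hs]
      have : (0 : ℝ) ≤ n := n.cast_nonneg
      nlinarith)
    simpa [ha, Nat.succ_eq_succ] using this
  have hstep : ∀ k, κ * μ (Ioc (a k) (a (k + 1))) ≤
      2 * ∫⁻ u in Ioc (a k) (a (k + 1)), ENNReal.ofReal (1 - Real.cos (s * u)) ∂μ := by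
    intro k
    have ha0 : u₀ < a k := by
      refine hsu.trans_le ?_
      have := hmono (Nat.zero_le k)
      simpa [ha] using this
    have h1 : μ (Ioc (b k) (a (k + 1))) ≤ μ (Ioc (a k) (b k)) := by
      refine measure_Ioc_le_of_convex_tail hμ ha0 (hab k) (hba k) ?_
      simp only [ha, hb]
      rw [← sub_div, ← sub_div, div_le_div_iff_of_pos_right hs]
      push_cast
      linarith
    have h2 : μ (Ioc (a k) (a (k + 1))) ≤ 2 * μ (Ioc (a k) (b k)) := by
      rw [← Ioc_union_Ioc_eq_Ioc (hab k).le (hba k).le, two_mul]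
      exact (measure_union_le _ _).trans (by gcongr)
    have h3 : κ * μ (Ioc (a k) (b k)) ≤
        ∫⁻ u in Ioc (a k) (b k), ENNReal.ofReal (1 - Real.cos (s * u)) ∂μ := by
      rw [← setLIntegral_const]
      refine setLIntegral_mono (measurable_cosIntegrand s) fun u hu => ?_
      have hu1 := hu.1
      have hu2 := hu.2
      simp only [ha, hb] at hu1 hu2
      rw [div_lt_iff₀ hs] at hu1
      rw [le_div_iff₀ hs] at hu2
      exact ENNReal.ofReal_le_ofReal
        (one_sub_cos_one_le (k := k) (by linarith) (by linarith))
    calc κ * μ (Ioc (a k) (a (k + 1))) ≤ κ * (2 * μ (Ioc (a k) (b k))) := by gcongr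
      _ = 2 * (κ * μ (Ioc (a k) (b k))) := by ring
      _ ≤ 2 * ∫⁻ u in Ioc (a k) (b k), ENNReal.ofReal (1 - Real.cos (s * u)) ∂μ := by gcongr
      _ ≤ _ := by
        gcongr
        exact (hba k).le
  calc κ * μ (Ioi (1 / s)) ≤ κ * ∑' k, μ (Ioc (a k) (a (k + 1))) := by
        rw [← hunion]
        gcongr
        exact measure_iUnion_le _
    _ = ∑' k, κ * μ (Ioc (a k) (a (k + 1))) := ENNReal.tsum_mul_left.symm
    _ ≤ ∑' k, 2 * ∫⁻ u in Ioc (a k) (a (k + 1)), ENNReal.ofReal (1 - Real.cos (s * u)) ∂μ :=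
        ENNReal.tsum_le_tsum hstep
    _ = 2 * ∫⁻ u in ⋃ k, Ioc (a k) (a (k + 1)), ENNReal.ofReal (1 - Real.cos (s * u)) ∂μ := by
        rw [ENNReal.tsum_mul_left, lintegral_iUnion (fun _ => measurableSet_Ioc)
          (by simpa [Nat.succ_eq_succ] using hmono.pairwise_disjoint_on_Ioc_succ)]
    _ ≤ 2 * cosIntegral μ s := by
        gcongr
        exact setLIntegral_le_lintegral _ _

/-- The comparison of the integrated tail with the cosine integral, reverse to `cosIntegral_le`,
for quasi-unimodal measures and small frequencies. -/
lemma integratedTail_le {μ : Measure ℝ} {u₀ s : ℝ} (hμ : IsQuasiUnimodal μ u₀) (hs : 0 < s)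
    (hsu : u₀ < 1 / s) :
    ENNReal.ofReal (s ^ 2) * integratedTail μ (1 / s) ≤ 8 * cosIntegral μ s := by
  have hs' : 0 ≤ 1 / s := by positivity
  have hcos : 1 / 5 ≤ 1 - Real.cos 1 := by linarith [Real.cos_one_le]
  have hpt : ∀ u : ℝ, ENNReal.ofReal (s ^ 2) * ENNReal.ofReal (min (max u 0) (1 / s) ^ 2 / 2) ≤
      3 * ENNReal.ofReal (1 - Real.cos (s * u)) +
        (Ioi (1 / s)).indicator (fun _ => ENNReal.ofReal (1 / 2)) u := by
    intro u
    rw [← ENNReal.ofReal_mul (by positivity)]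
    rcases le_or_gt u (1 / s) with h | h
    · rw [indicator_of_notMem (by simpa using h), add_zero,
        show (3 : ℝ≥0∞) = ENNReal.ofReal 3 by simp, ← ENNReal.ofReal_mul (by norm_num)]
      refine ENNReal.ofReal_le_ofReal ?_
      rcases le_total u 0 with h0 | h0
      · rw [max_eq_right h0, min_eq_left hs']
        nlinarith [Real.cos_le_one (s * u)]
      · rw [max_eq_left h0, min_eq_left h]
        have hsu1 : s * u ≤ 1 := by rw [le_div_iff₀ hs] at h; linarith
        have hsu0 : 0 ≤ s * u := by positivity
        have hpi := Real.pi_gt_three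
        have hpi' := Real.pi_lt_d2
        have := Real.cos_le_one_sub_mul_cos_sq (x := s * u)
          (by rw [abs_of_nonneg hsu0]; linarith)
        have h5 : 1 / 6 ≤ 2 / Real.pi ^ 2 := by
          rw [div_le_div_iff₀ (by norm_num) (by positivity)]
          nlinarith
        nlinarith [mul_le_mul_of_nonneg_right h5 (sq_nonneg (s * u))]
    · rw [indicator_of_mem (by simpa using h),
        min_eq_right (h.le.trans (le_max_left _ _)),
        show s ^ 2 * ((1 / s) ^ 2 / 2) = 1 / 2 by field_simp]
      exact le_add_self
  have htail : ENNReal.ofReal (1 / 2) * μ (Ioi (1 / s)) ≤ 5 * cosIntegral μ s := by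
    have h1 := tail_le_cosIntegral hμ hs hsu
    have h2 : ENNReal.ofReal (1 / 2) ≤ ENNReal.ofReal (5 / 2) * ENNReal.ofReal (1 - Real.cos 1) := by
      rw [← ENNReal.ofReal_mul (by norm_num)]
      exact ENNReal.ofReal_le_ofReal (by linarith)
    calc ENNReal.ofReal (1 / 2) * μ (Ioi (1 / s))
        ≤ ENNReal.ofReal (5 / 2) * ENNReal.ofReal (1 - Real.cos 1) * μ (Ioi (1 / s)) := by gcongr
      _ ≤ ENNReal.ofReal (5 / 2) * (2 * cosIntegral μ s) := by rw [mul_assoc]; gcongr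
      _ = 5 * cosIntegral μ s := by
        rw [← mul_assoc, show (2 : ℝ≥0∞) = ENNReal.ofReal 2 by simp,
          ← ENNReal.ofReal_mul (by norm_num)]
        norm_num
  rw [integratedTail_eq_lintegral μ hs', ← lintegral_const_mul' _ _ ENNReal.ofReal_ne_top]
  calc _ ≤ ∫⁻ u, (3 * ENNReal.ofReal (1 - Real.cos (s * u)) +
        (Ioi (1 / s)).indicator (fun _ => ENNReal.ofReal (1 / 2)) u) ∂μ := lintegral_mono hpt
    _ = 3 * cosIntegral μ s + ENNReal.ofReal (1 / 2) * μ (Ioi (1 / s)) := by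
        rw [lintegral_add_left ((measurable_cosIntegrand s).const_mul _),
          lintegral_const_mul _ (measurable_cosIntegrand s),
          lintegral_indicator_const measurableSet_Ioi, cosIntegral]
    _ ≤ 3 * cosIntegral μ s + 5 * cosIntegral μ s := by gcongr
    _ = 8 * cosIntegral μ s := by rw [← add_mul]; norm_num

/-! ### The radial symbol as a function of the frequency -/

/-- The integrand of the Lévy–Khintchine formula is integrable: it is bounded by a multiple of
`min 1 (‖y‖ ^ 2)`. -/
lemma integrable_levyIntegrand {d : ℕ} {m : Measure (Euc d)}
    (hm : ∫⁻ y, ENNReal.ofReal (min 1 (‖y‖ ^ 2)) ∂m < ⊤) (ξ : Euc d) :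
    Integrable (fun y => 1 - exp (I * (⟪ξ, y⟫_ℝ : ℝ))
      + I * (⟪ξ, y⟫_ℝ : ℝ) * (ball (0 : Euc d) 1).indicator (fun _ => (1 : ℂ)) y) m := by
  have hg : Integrable (fun y : Euc d => min 1 (‖y‖ ^ 2)) m := by
    refine ⟨by fun_prop, ?_⟩
    rwa [hasFiniteIntegral_iff_ofReal (ae_of_all _ fun y => by positivity)]
  refine (hg.const_mul (2 + 3 * ‖ξ‖ ^ 2)).mono' ?_ (ae_of_all _ fun y => ?_)
  · have h1 : Measurable ((ball (0 : Euc d) 1).indicator (fun _ => (1 : ℂ))) :=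
      measurable_const.indicator measurableSet_ball
    exact (by fun_prop : Measurable _).aestronglyMeasurable
  set t : ℝ := ⟪ξ, y⟫_ℝ with ht
  have hexp : ‖exp (I * t)‖ = 1 := by rw [mul_comm]; exact norm_exp_ofReal_mul_I t
  have hIt : ‖I * (t : ℂ)‖ = |t| := by simp
  have htξ : |t| ≤ ‖ξ‖ * ‖y‖ := abs_real_inner_le_norm ξ y
  by_cases hy : y ∈ ball (0 : Euc d) 1
  · have hy1 : ‖y‖ < 1 := by simpa using hy
    have hmin : min 1 (‖y‖ ^ 2) = ‖y‖ ^ 2 :=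
      min_eq_right (by nlinarith [norm_nonneg y])
    have hb : ‖1 - exp (I * t) + I * t * 1‖ ≤ 3 * |t| ^ 2 := by
      rcases le_total |t| 1 with h | h
      · have := norm_exp_sub_one_sub_id_le (x := I * t) (by rwa [hIt])
        rw [hIt] at this
        rw [show 1 - exp (I * t) + I * t * 1 = -(exp (I * t) - 1 - I * t) by ring, norm_neg]
        nlinarith [sq_nonneg |t|]
      · calc ‖1 - exp (I * t) + I * t * 1‖ ≤ ‖(1 : ℂ)‖ + ‖exp (I * t)‖ + ‖I * (t : ℂ) * 1‖ :=
              (norm_add_le _ _).trans (by gcongr; exact norm_sub_le _ _)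
          _ = 2 + |t| := by rw [mul_one, hIt, hexp, norm_one]; norm_num
          _ ≤ 3 * |t| ^ 2 := by nlinarith
    rw [indicator_of_mem hy, hmin]
    calc _ ≤ 3 * |t| ^ 2 := hb
      _ ≤ 3 * (‖ξ‖ * ‖y‖) ^ 2 := by gcongr
      _ ≤ _ := by nlinarith [sq_nonneg ‖y‖]
  · have hy1 : 1 ≤ ‖y‖ := by simpa using hy
    have hmin : min 1 (‖y‖ ^ 2) = 1 := min_eq_left (by nlinarith)
    rw [indicator_of_notMem hy, hmin, mul_zero, add_zero]
    calc ‖1 - exp (I * t)‖ ≤ ‖(1 : ℂ)‖ + ‖exp (I * t)‖ := norm_sub_le _ _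
      _ = 2 := by rw [hexp, norm_one]; norm_num
      _ ≤ _ := by nlinarith [sq_nonneg ‖ξ‖]

lemma lintegral_one_sub_cos_lt_top {d : ℕ} {m : Measure (Euc d)}
    (hm : ∫⁻ y, ENNReal.ofReal (min 1 (‖y‖ ^ 2)) ∂m < ⊤) (ξ : Euc d) :
    ∫⁻ y, ENNReal.ofReal (1 - Real.cos ⟪ξ, y⟫_ℝ) ∂m < ⊤ := by
  have h := (integrable_levyIntegrand hm ξ).re
  have h2 := h.hasFiniteIntegral
  rw [hasFiniteIntegral_iff_norm] at h2
  refine lt_of_le_of_lt (lintegral_mono fun y => ENNReal.ofReal_le_ofReal ?_) h2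
  refine le_trans (le_of_eq ?_) (le_abs_self _)
  by_cases hy : y ∈ ball (0 : Euc d) 1 <;>
  simp [hy, exp_re]

lemma levySymbol_re {d : ℕ} {ν : Kernel (Euc d) (Euc d)} (c : Euc d → ℝ) {x : Euc d}
    (hm : ∫⁻ y, ENNReal.ofReal (min 1 (‖y‖ ^ 2)) ∂(ν x) < ⊤) (ξ : Euc d) :
    (levySymbol (fun _ => 0) (fun x => c x • (1 : Matrix (Fin d) (Fin d) ℝ)) ν x ξ).re =
      c x * ‖ξ‖ ^ 2 / 2 + (∫⁻ y, ENNReal.ofReal (1 - Real.cos ⟪ξ, y⟫_ℝ) ∂(ν x)).toReal := by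
  have hint := integrable_levyIntegrand hm ξ
  have hre : ∀ y : Euc d, (1 - exp (I * (⟪ξ, y⟫_ℝ : ℝ))
      + I * (⟪ξ, y⟫_ℝ : ℝ) * (ball (0 : Euc d) 1).indicator (fun _ => (1 : ℂ)) y).re
      = 1 - Real.cos ⟪ξ, y⟫_ℝ := by
    intro y
    by_cases hy : y ∈ ball (0 : Euc d) 1 <;> simp [hy, exp_re]
  have h1 := integral_re hint
  simp only [RCLike.re_to_complex, hre] at h1
  rw [← integral_eq_lintegral_of_nonneg_ae
    (ae_of_all _ fun y => by simpa using Real.cos_le_one _) (by fun_prop), h1]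
  have h3 : ξ.ofLp ⬝ᵥ ((c x • (1 : Matrix (Fin d) (Fin d) ℝ)) *ᵥ ξ.ofLp) = c x * ‖ξ‖ ^ 2 := by
    rw [smul_mulVec, one_mulVec, dotProduct_smul, smul_eq_mul, EuclideanSpace.real_norm_sq_eq]
    simp [dotProduct, sq]
  simp only [levySymbol, h3, inner_zero_right, add_re]
  simp [-ofReal_pow]
  ring

lemma levySymbol_neg {d : ℕ} (ν : Kernel (Euc d) (Euc d)) (C : Euc d → Matrix (Fin d) (Fin d) ℝ)
    (x ξ : Euc d) :
    levySymbol (fun _ => 0) C ν x (-ξ) =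
      (starRingEnd ℂ) (levySymbol (fun _ => 0) C ν x ξ) := by
  simp only [levySymbol, map_add, ← integral_conj]
  congr 1
  · simp [mulVec_neg, conj_ofNat]
  · refine integral_congr_ae (ae_of_all _ fun y => ?_)
    by_cases hy : y ∈ ball (0 : Euc d) 1 <;> simp [hy, ← Complex.exp_conj]

/-- The rotations act transitively on the circles. -/
lemma exists_planeRotation_eq (ξ : Euc 2) :
    ∃ φ ∈ Ico 0 (2 * Real.pi), planeRotation φ !₂[‖ξ‖, 0] = ξ := by
  set z : ℂ := ⟨ξ 0, ξ 1⟩ with hz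
  have hnorm : ‖ξ‖ = ‖z‖ := by
    rw [EuclideanSpace.norm_eq, Complex.norm_eq_sqrt_sq_add_sq]
    simp [hz]
  have hpi := Real.pi_pos
  have h1 := Complex.norm_mul_cos_arg z
  have h2 := Complex.norm_mul_sin_arg z
  have h3 := Complex.neg_pi_lt_arg z
  have h4 := Complex.arg_le_pi z
  have aux : ∀ φ, Real.cos φ = Real.cos z.arg → Real.sin φ = Real.sin z.arg →
      planeRotation φ !₂[‖ξ‖, 0] = ξ := by
    intro φ hc hs
    ext i
    fin_cases i
    · have : Real.cos z.arg * ‖z‖ = ξ 0 := by rw [mul_comm, h1]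
      simpa [planeRotation, hc, hs, hnorm] using this
    · have : Real.sin z.arg * ‖z‖ = ξ 1 := by rw [mul_comm, h2]
      simpa [planeRotation, hc, hs, hnorm] using this
  rcases lt_or_ge z.arg 0 with h | h
  · exact ⟨z.arg + 2 * Real.pi, ⟨by linarith, by linarith⟩,
      aux _ (Real.cos_add_two_pi _) (Real.sin_add_two_pi _)⟩
  · exact ⟨z.arg, ⟨h, by linarith⟩, aux _ rfl rfl⟩

lemma IsRadial.eq_of_norm_eq {f : Euc 2 → ℂ} (hf : IsRadial f) {ξ η : Euc 2} (h : ‖ξ‖ = ‖η‖) :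
    f ξ = f η := by
  obtain ⟨φ, hφ, hξ⟩ := exists_planeRotation_eq ξ
  obtain ⟨θ, hθ, hη⟩ := exists_planeRotation_eq η
  rw [← hξ, ← hη, hf _ φ hφ, hf _ θ hθ, h]

/-- The radial profile of the symbol with diffusion coefficient `a` and first marginal `μ` of
the jump measure, with values in `[0,∞]`. -/
noncomputable def radialProfile (a : ℝ) (μ : Measure ℝ) (s : ℝ) : ℝ≥0∞ :=
  ENNReal.ofReal (a * s ^ 2 / 2) + cosIntegral μ s

lemma inner_axis (s : ℝ) (y : Euc 2) : ⟪(!₂[s, 0] : Euc 2), y⟫_ℝ = s * y 0 := by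
  simp [PiLp.inner_apply, mul_comm]

lemma norm_axis {s : ℝ} (hs : 0 ≤ s) : ‖(!₂[s, 0] : Euc 2)‖ = s := by
  simp [EuclideanSpace.norm_eq, Real.sqrt_sq hs]

lemma cosIntegral_firstMarginal (ν : Kernel (Euc 2) (Euc 2)) (x : Euc 2) (s : ℝ) :
    cosIntegral (firstMarginal ν x) s =
      ∫⁻ y, ENNReal.ofReal (1 - Real.cos ⟪(!₂[s, 0] : Euc 2), y⟫_ℝ) ∂(ν x) := by
  simp only [inner_axis]
  rw [cosIntegral, firstMarginal, lintegral_map (measurable_cosIntegrand s) (by fun_prop)]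

lemma truncN_eq_integratedTail (ν : Kernel (Euc 2) (Euc 2)) (x : Euc 2) (ρ : ℝ) :
    truncN ν x ρ = integratedTail (firstMarginal ν x) ρ := by
  unfold truncN integratedTail tailN firstMarginal
  refine lintegral_congr fun u => ?_
  rw [Measure.map_apply (by fun_prop) measurableSet_Ioi]
  rfl

section Radial

variable {c : Euc 2 → ℝ} {ν : Kernel (Euc 2) (Euc 2)} {x : Euc 2}

lemma levySymbol_eq_ofReal_of_isRadial
    (hr : IsRadial (levySymbol (fun _ => 0) (fun x => c x • (1 : Matrix (Fin 2) (Fin 2) ℝ)) ν x))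
    (ξ : Euc 2) :
    levySymbol (fun _ => 0) (fun x => c x • (1 : Matrix (Fin 2) (Fin 2) ℝ)) ν x ξ =
      ((levySymbol (fun _ => 0) (fun x => c x • (1 : Matrix (Fin 2) (Fin 2) ℝ)) ν x ξ).re : ℂ) := by
  have h := levySymbol_neg ν (fun x => c x • (1 : Matrix (Fin 2) (Fin 2) ℝ)) x ξ
  rw [hr.eq_of_norm_eq (norm_neg ξ)] at h
  exact (conj_eq_iff_re.1 h.symm).symm

lemma ofReal_levySymbol_re
    (hm : ∫⁻ y, ENNReal.ofReal (min 1 (‖y‖ ^ 2)) ∂(ν x) < ⊤) (hc : 0 ≤ c x) (ξ : Euc 2) :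
    ENNReal.ofReal
        (levySymbol (fun _ => 0) (fun x => c x • (1 : Matrix (Fin 2) (Fin 2) ℝ)) ν x ξ).re =
      ENNReal.ofReal (c x * ‖ξ‖ ^ 2 / 2) +
        ∫⁻ y, ENNReal.ofReal (1 - Real.cos ⟪ξ, y⟫_ℝ) ∂(ν x) := by
  rw [levySymbol_re c hm, ENNReal.ofReal_add (by positivity) ENNReal.toReal_nonneg,
    ENNReal.ofReal_toReal (lintegral_one_sub_cos_lt_top hm ξ).ne]

lemma ofReal_levySymbol_re_eq_radialProfile
    (hm : ∫⁻ y, ENNReal.ofReal (min 1 (‖y‖ ^ 2)) ∂(ν x) < ⊤) (hc : 0 ≤ c x)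
    (hr : IsRadial (levySymbol (fun _ => 0) (fun x => c x • (1 : Matrix (Fin 2) (Fin 2) ℝ)) ν x))
    (ξ : Euc 2) :
    ENNReal.ofReal
        (levySymbol (fun _ => 0) (fun x => c x • (1 : Matrix (Fin 2) (Fin 2) ℝ)) ν x ξ).re =
      radialProfile (c x) (firstMarginal ν x) ‖ξ‖ := by
  rw [hr.eq_of_norm_eq (norm_axis (norm_nonneg ξ)).symm, ofReal_levySymbol_re hm hc,
    radialProfile, cosIntegral_firstMarginal, norm_axis (norm_nonneg ξ)]

lemma enorm_levySymbol
    (hm : ∫⁻ y, ENNReal.ofReal (min 1 (‖y‖ ^ 2)) ∂(ν x) < ⊤) (hc : 0 ≤ c x)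
    (hr : IsRadial (levySymbol (fun _ => 0) (fun x => c x • (1 : Matrix (Fin 2) (Fin 2) ℝ)) ν x))
    (ξ : Euc 2) :
    ‖levySymbol (fun _ => 0) (fun x => c x • (1 : Matrix (Fin 2) (Fin 2) ℝ)) ν x ξ‖ₑ =
      radialProfile (c x) (firstMarginal ν x) ‖ξ‖ := by
  have h0 : 0 ≤ (levySymbol (fun _ => 0)
      (fun x => c x • (1 : Matrix (Fin 2) (Fin 2) ℝ)) ν x ξ).re := by
    rw [levySymbol_re c hm]
    positivity
  rw [← ofReal_levySymbol_re_eq_radialProfile hm hc hr, levySymbol_eq_ofReal_of_isRadial hr,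
    ← ofReal_norm, norm_real, Real.norm_of_nonneg h0, ofReal_re]

/-- Every vector of length `t ≤ s` is a sum of two vectors of length `s`, so that the
subadditivity of the square root of the symbol gives a doubling inequality for its profile. -/
lemma radialProfile_le
    (hm : ∫⁻ y, ENNReal.ofReal (min 1 (‖y‖ ^ 2)) ∂(ν x) < ⊤) (hc : 0 ≤ c x)
    (hr : IsRadial (levySymbol (fun _ => 0) (fun x => c x • (1 : Matrix (Fin 2) (Fin 2) ℝ)) ν x))
    {s t : ℝ} (ht : 0 ≤ t) (hts : t ≤ s) :
    radialProfile (c x) (firstMarginal ν x) t ≤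
      4 * radialProfile (c x) (firstMarginal ν x) s := by
  have hs : 0 ≤ s := ht.trans hts
  set h := √(s ^ 2 - (t / 2) ^ 2) with hh
  have hsq : h ^ 2 = s ^ 2 - (t / 2) ^ 2 := Real.sq_sqrt (by nlinarith)
  set ξ : Euc 2 := !₂[t / 2, h] with hξ
  set η : Euc 2 := !₂[t / 2, -h] with hη
  have hξn : ‖ξ‖ = s := by
    rw [EuclideanSpace.norm_eq]
    simp [hξ, hsq, Real.sqrt_sq hs]
  have hηn : ‖η‖ = s := by
    rw [EuclideanSpace.norm_eq]
    simp [hη, hsq, Real.sqrt_sq hs]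
  have hsum : ξ + η = !₂[t, 0] := by
    ext i
    fin_cases i <;> simp [hξ, hη]
  have hcos : ∀ α β : ℝ, 1 - Real.cos (α + β) ≤
      2 * (1 - Real.cos α) + 2 * (1 - Real.cos β) := by
    intro α β
    rw [Real.cos_add]
    nlinarith [Real.sin_sq_add_cos_sq α, Real.sin_sq_add_cos_sq β,
      sq_nonneg (Real.sin α - Real.sin β), sq_nonneg (Real.cos α + Real.cos β - 2)]
  have hjump : cosIntegral (firstMarginal ν x) t ≤
      2 * ∫⁻ y, ENNReal.ofReal (1 - Real.cos ⟪ξ, y⟫_ℝ) ∂(ν x) +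
        2 * ∫⁻ y, ENNReal.ofReal (1 - Real.cos ⟪η, y⟫_ℝ) ∂(ν x) := by
    rw [cosIntegral_firstMarginal, ← hsum, ← lintegral_const_mul _ (by fun_prop),
      ← lintegral_const_mul _ (by fun_prop), ← lintegral_add_left (by fun_prop)]
    refine lintegral_mono fun y => ?_
    have := hcos ⟪ξ, y⟫_ℝ ⟪η, y⟫_ℝ
    rw [← inner_add_left] at this
    refine (ENNReal.ofReal_le_ofReal this).trans ?_
    rw [ENNReal.ofReal_add, ENNReal.ofReal_mul zero_le_two, ENNReal.ofReal_mul zero_le_two]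
    · simp
    · linarith [Real.cos_le_one ⟪ξ, y⟫_ℝ]
    · linarith [Real.cos_le_one ⟪η, y⟫_ℝ]
  have hdiff : ENNReal.ofReal (c x * t ^ 2 / 2) ≤ 4 * ENNReal.ofReal (c x * s ^ 2 / 2) := by
    rw [show (4 : ℝ≥0∞) = ENNReal.ofReal 4 by simp, ← ENNReal.ofReal_mul (by norm_num)]
    refine ENNReal.ofReal_le_ofReal ?_
    have : c x * t ^ 2 ≤ c x * s ^ 2 := by gcongr
    nlinarith [mul_nonneg hc (sq_nonneg s)]
  have key : ∀ ζ : Euc 2, ‖ζ‖ = s → ENNReal.ofReal (c x * s ^ 2 / 2) +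
      ∫⁻ y, ENNReal.ofReal (1 - Real.cos ⟪ζ, y⟫_ℝ) ∂(ν x) =
      radialProfile (c x) (firstMarginal ν x) s := by
    intro ζ hζ
    rw [← hζ, ← ofReal_levySymbol_re hm hc, ofReal_levySymbol_re_eq_radialProfile hm hc hr]
  calc radialProfile (c x) (firstMarginal ν x) t
      ≤ 4 * ENNReal.ofReal (c x * s ^ 2 / 2) +
        (2 * ∫⁻ y, ENNReal.ofReal (1 - Real.cos ⟪ξ, y⟫_ℝ) ∂(ν x) +
        2 * ∫⁻ y, ENNReal.ofReal (1 - Real.cos ⟪η, y⟫_ℝ) ∂(ν x)) := add_le_add hdiff hjump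
    _ = 2 * (ENNReal.ofReal (c x * s ^ 2 / 2) +
          ∫⁻ y, ENNReal.ofReal (1 - Real.cos ⟪ξ, y⟫_ℝ) ∂(ν x)) +
        2 * (ENNReal.ofReal (c x * s ^ 2 / 2) +
          ∫⁻ y, ENNReal.ofReal (1 - Real.cos ⟪η, y⟫_ℝ) ∂(ν x)) := by ring
    _ = 4 * radialProfile (c x) (firstMarginal ν x) s := by
      rw [key ξ hξn, key η hηn]
      ring

end Radial

/-! ### Comparison of radial integrals in the plane with integrals over a half-line -/

lemma lintegral_ball_norm {g : ℝ → ℝ≥0∞} (hg : Measurable g) (δ : ℝ) :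
    ∫⁻ ξ in ball (0 : Euc 2) δ, g ‖ξ‖ =
      (volume : Measure (Euc 2)).toSphere univ * ∫⁻ s in Ioo 0 δ, ENNReal.ofReal s * g s := by
  set f : ℝ → ℝ≥0∞ := (Iio δ).indicator g with hf
  have hfm : Measurable f := hg.indicator measurableSet_Iio
  have h1 : ∫⁻ ξ in ball (0 : Euc 2) δ, g ‖ξ‖ = ∫⁻ ξ : Euc 2, f ‖ξ‖ := by
    rw [← lintegral_indicator measurableSet_ball]
    refine lintegral_congr fun ξ => ?_
    by_cases h : ‖ξ‖ < δ <;> simp [hf, h]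
  have h2 : ∫⁻ ξ : Euc 2, f ‖ξ‖ =
      ∫⁻ ξ : ({(0)}ᶜ : Set (Euc 2)), f ‖ξ.1‖ ∂((volume : Measure (Euc 2)).comap (↑)) := by
    rw [lintegral_subtype_comap (measurableSet_singleton _).compl fun ξ : Euc 2 => f ‖ξ‖,
      restrict_compl_singleton]
  have h3 : ∫⁻ ξ : ({(0)}ᶜ : Set (Euc 2)), f ‖ξ.1‖ ∂((volume : Measure (Euc 2)).comap (↑)) =
      ∫⁻ p, f p.2 ∂(volume : Measure (Euc 2)).toSphere.prod
        (.volumeIoiPow (Module.finrank ℝ (Euc 2) - 1)) := by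
    have := (volume : Measure (Euc 2)).measurePreserving_homeomorphUnitSphereProd.lintegral_comp
      (f := fun p => f p.2) (by fun_prop)
    simpa using this
  have h4 : ∫⁻ p, f p.2 ∂(volume : Measure (Euc 2)).toSphere.prod
        (.volumeIoiPow (Module.finrank ℝ (Euc 2) - 1)) =
      (volume : Measure (Euc 2)).toSphere univ *
        ∫⁻ s : Ioi (0 : ℝ), f s ∂(.volumeIoiPow (Module.finrank ℝ (Euc 2) - 1)) := by
    rw [lintegral_prod _ (by fun_prop)]
    simp [mul_comm]
  rw [h1, h2, h3, h4]
  congr 1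
  rw [Measure.volumeIoiPow, lintegral_withDensity_eq_lintegral_mul _ (by fun_prop) (by fun_prop)]
  simp only [Pi.mul_apply]
  rw [lintegral_subtype_comap measurableSet_Ioi
    fun s : ℝ => ENNReal.ofReal (s ^ (Module.finrank ℝ (Euc 2) - 1)) * f s,
    ← lintegral_indicator measurableSet_Ioi, ← lintegral_indicator measurableSet_Ioo]
  refine lintegral_congr fun s => ?_
  by_cases h0 : 0 < s <;> by_cases hs : s < δ <;> simp [hf, h0, hs]

/-- The substitution `ρ = 1 / s`. -/
lemma lintegral_Ioo_eq_lintegral_Ioi (G : ℝ → ℝ≥0∞) {δ : ℝ} (hδ : 0 < δ) :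
    ∫⁻ s in Ioo 0 δ, ENNReal.ofReal s * (ENNReal.ofReal (s ^ 2) * G (1 / s))⁻¹ =
      ∫⁻ ρ in Ioi (1 / δ), (ENNReal.ofReal ρ * G ρ)⁻¹ := by
  have himage : (fun s : ℝ => s⁻¹) '' Ioo 0 δ = Ioi (1 / δ) := by
    rw [image_inv_eq_inv, one_div, inv_Ioo_0_left hδ]
  rw [← himage, lintegral_image_eq_lintegral_abs_deriv_mul measurableSet_Ioo
    (f' := fun s => -(s ^ 2)⁻¹)
    (fun s hs => (hasDerivAt_inv hs.1.ne').hasDerivWithinAt) inv_injective.injOn]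
  refine setLIntegral_congr_fun measurableSet_Ioo fun s hs => ?_
  have hs0 : 0 < s := hs.1
  have h1 : 0 < s⁻¹ := by positivity
  have h2 : 0 < s ^ 2 := by positivity
  rw [ENNReal.mul_inv (.inl (ENNReal.ofReal_pos.2 h2).ne') (.inl ENNReal.ofReal_ne_top),
    ENNReal.mul_inv (.inl (ENNReal.ofReal_pos.2 h1).ne') (.inl ENNReal.ofReal_ne_top),
    ← mul_assoc, ← mul_assoc, ← ENNReal.ofReal_inv_of_pos h2, ← ENNReal.ofReal_inv_of_pos h1,
    ← ENNReal.ofReal_mul hs0.le, ← ENNReal.ofReal_mul (abs_nonneg _), abs_neg,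
    abs_of_pos (inv_pos.2 h2), inv_inv, one_div, mul_comm s]

lemma lintegral_ball_eq_lintegral_Ioi {G : ℝ → ℝ≥0∞} (hG : Monotone G) {δ : ℝ} (hδ : 0 < δ) :
    ∫⁻ ξ in ball (0 : Euc 2) δ, (ENNReal.ofReal (‖ξ‖ ^ 2) * G (1 / ‖ξ‖))⁻¹ =
      (volume : Measure (Euc 2)).toSphere univ *
        ∫⁻ ρ in Ioi (1 / δ), (ENNReal.ofReal ρ * G ρ)⁻¹ := by
  have hGm := hG.measurable
  rw [← lintegral_Ioo_eq_lintegral_Ioi G hδ, ← lintegral_ball_norm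
    (g := fun s => (ENNReal.ofReal (s ^ 2) * G (1 / s))⁻¹)]
  fun_prop

/-- `H₁` and `H₂` need not be measurable: lower integrals are monotone, and constants can be
taken out of them, for arbitrary functions. -/
lemma lintegral_ball_inv_mono {H₁ H₂ : ℝ → ℝ≥0∞} {C : ℝ≥0∞} (hC0 : C ≠ 0) (hC : C ≠ ⊤) {δ : ℝ}
    (h : ∀ s, 0 < s → s < δ → H₁ s ≤ C * H₂ s) :
    ∫⁻ ξ in ball (0 : Euc 2) δ, (H₂ ‖ξ‖)⁻¹ ≤ C * ∫⁻ ξ in ball (0 : Euc 2) δ, (H₁ ‖ξ‖)⁻¹ := by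
  rw [← lintegral_const_mul' _ _ hC]
  refine lintegral_mono_ae ?_
  have h0 : ∀ᵐ ξ : Euc 2 ∂(volume.restrict (ball (0 : Euc 2) δ)), ξ ≠ 0 :=
    ae_restrict_of_ae (compl_mem_ae_iff.2 (measure_singleton 0))
  filter_upwards [h0, ae_restrict_mem measurableSet_ball] with ξ hξ hξδ
  have := h ‖ξ‖ (norm_pos_iff.2 hξ) (by simpa using hξδ)
  calc (H₂ ‖ξ‖)⁻¹ = C * (C * H₂ ‖ξ‖)⁻¹ := by
        rw [ENNReal.mul_inv (.inl hC0) (.inl hC), ← mul_assoc, ENNReal.mul_inv_cancel hC0 hC,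
          one_mul]
    _ ≤ C * (H₁ ‖ξ‖)⁻¹ := by gcongr

lemma lintegral_ball_eq_top {G H : ℝ → ℝ≥0∞} (hG : Monotone G) {C : ℝ≥0∞} (hC0 : C ≠ 0)
    (hC : C ≠ ⊤) {δ : ℝ} (hδ : 0 < δ)
    (h : ∀ s, 0 < s → s < δ → H s ≤ C * (ENNReal.ofReal (s ^ 2) * G (1 / s)))
    (hint : ∫⁻ ρ in Ioi (1 / δ), (ENNReal.ofReal ρ * G ρ)⁻¹ = ⊤) :
    ∫⁻ ξ in ball (0 : Euc 2) δ, (H ‖ξ‖)⁻¹ = ⊤ := by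
  have h1 := lintegral_ball_inv_mono hC0 hC h
  rw [lintegral_ball_eq_lintegral_Ioi hG hδ, hint,
    ENNReal.mul_top (by simp [Real.pi_pos]), top_le_iff] at h1
  by_contra hne
  exact ENNReal.mul_ne_top hC hne h1

lemma lintegral_Ioi_eq_top {G H : ℝ → ℝ≥0∞} (hG : Monotone G) {C : ℝ≥0∞} (hC0 : C ≠ 0)
    (hC : C ≠ ⊤) {δ : ℝ} (hδ : 0 < δ)
    (h : ∀ s, 0 < s → s < δ → ENNReal.ofReal (s ^ 2) * G (1 / s) ≤ C * H s)
    (hint : ∫⁻ ξ in ball (0 : Euc 2) δ, (H ‖ξ‖)⁻¹ = ⊤) :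
    ∫⁻ ρ in Ioi (1 / δ), (ENNReal.ofReal ρ * G ρ)⁻¹ = ⊤ := by
  have h1 := lintegral_ball_inv_mono hC0 hC h
  rw [lintegral_ball_eq_lintegral_Ioi hG hδ, hint, top_le_iff] at h1
  by_contra hne
  exact ENNReal.mul_ne_top hC (ENNReal.mul_ne_top (measure_ne_top _ _) hne) h1

lemma lintegral_Ioi_inv_eq_top : ∫⁻ ρ in Ioi (1 : ℝ), (ENNReal.ofReal ρ)⁻¹ = ⊤ := by
  by_contra hne
  refine not_integrableOn_Ioi_inv (a := 1) ⟨by fun_prop, ?_⟩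
  rw [hasFiniteIntegral_iff_ofReal]
  · refine lt_of_eq_of_lt (setLIntegral_congr_fun measurableSet_Ioi fun ρ hρ => ?_)
      (lt_top_iff_ne_top.2 hne)
    exact ENNReal.ofReal_inv_of_pos (zero_lt_one.trans hρ)
  · filter_upwards [ae_restrict_mem measurableSet_Ioi] with ρ hρ
    exact (inv_pos.2 (zero_lt_one.trans (mem_Ioi.1 hρ))).le

/-- A doubling-type inequality `H t ≤ 4 H s` for `t ≤ s` confines the divergence of the integral of
`1 / H` to a neighbourhood of the origin. -/
lemma lintegral_ball_eq_top_of_le {H : ℝ → ℝ≥0∞} (hH : ∀ t s, 0 ≤ t → t ≤ s → H t ≤ 4 * H s)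
    {δ r : ℝ} (hδ : 0 < δ) (hH0 : H (δ / 2) ≠ 0)
    (hint : ∫⁻ ξ in ball (0 : Euc 2) r, (H ‖ξ‖)⁻¹ = ⊤) :
    ∫⁻ ξ in ball (0 : Euc 2) δ, (H ‖ξ‖)⁻¹ = ⊤ := by
  by_contra hne
  have h1 : ∫⁻ ξ in ball (0 : Euc 2) r \ ball 0 δ, (H ‖ξ‖)⁻¹ ≤
      4 * (H (δ / 2))⁻¹ * volume (ball (0 : Euc 2) r) := by
    calc _ ≤ ∫⁻ ξ in ball (0 : Euc 2) r \ ball 0 δ, 4 * (H (δ / 2))⁻¹ := by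
          refine setLIntegral_mono measurable_const fun ξ hξ => ?_
          have hξδ : δ ≤ ‖ξ‖ := by simpa using hξ.2
          have h2 := hH (δ / 2) ‖ξ‖ (by positivity) (by linarith)
          calc (H ‖ξ‖)⁻¹ = 4 * (4 * H ‖ξ‖)⁻¹ := by
                rw [ENNReal.mul_inv (by simp) (by simp), ← mul_assoc,
                  ENNReal.mul_inv_cancel (by simp) (by simp), one_mul]
            _ ≤ _ := by gcongr
      _ ≤ _ := by
        rw [setLIntegral_const]
        gcongr
        exact sdiff_subset
  have h2 : 4 * (H (δ / 2))⁻¹ * volume (ball (0 : Euc 2) r) ≠ ⊤ :=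
    ENNReal.mul_ne_top (ENNReal.mul_ne_top (by simp) (ENNReal.inv_ne_top.2 hH0))
      measure_ball_lt_top.ne
  have h3 : ∫⁻ ξ in ball (0 : Euc 2) r, (H ‖ξ‖)⁻¹ ≤
      (∫⁻ ξ in ball (0 : Euc 2) δ, (H ‖ξ‖)⁻¹) +
        ∫⁻ ξ in ball (0 : Euc 2) r \ ball 0 δ, (H ‖ξ‖)⁻¹ := by
    refine (lintegral_mono_set ?_).trans (lintegral_union_le _ _ _)
    rw [union_sdiff_self]
    exact subset_union_right
  rw [hint, top_le_iff] at h3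
  exact ENNReal.add_ne_top.2 ⟨hne, ne_top_of_le_ne_top h2 h1⟩ h3

/-- For monotone `G` that is positive at `r > 0`, the divergence of the tail integral does not
depend on its lower end. -/
lemma lintegral_Ioi_eq_top_of_pos {G : ℝ → ℝ≥0∞} (hG : Monotone G) {r R : ℝ} (hr : 0 < r)
    (hG0 : G r ≠ 0) (hint : ∫⁻ ρ in Ioi r, (ENNReal.ofReal ρ * G ρ)⁻¹ = ⊤) :
    ∫⁻ ρ in Ioi R, (ENNReal.ofReal ρ * G ρ)⁻¹ = ⊤ := by
  by_contra hne
  have h1 : ∫⁻ ρ in Ioc r R, (ENNReal.ofReal ρ * G ρ)⁻¹ ≤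
      (ENNReal.ofReal r * G r)⁻¹ * volume (Ioc r R) := by
    rw [← setLIntegral_const]
    refine setLIntegral_mono measurable_const fun ρ hρ => ?_
    gcongr
    · exact hρ.1.le
    · exact hG hρ.1.le
  have h2 : (ENNReal.ofReal r * G r)⁻¹ * volume (Ioc r R) ≠ ⊤ := by
    refine ENNReal.mul_ne_top (ENNReal.inv_ne_top.2 (mul_ne_zero ?_ hG0)) measure_Ioc_lt_top.ne
    simpa using hr
  have h3 : ∫⁻ ρ in Ioi r, (ENNReal.ofReal ρ * G ρ)⁻¹ ≤
      (∫⁻ ρ in Ioc r R, (ENNReal.ofReal ρ * G ρ)⁻¹) +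
        ∫⁻ ρ in Ioi R, (ENNReal.ofReal ρ * G ρ)⁻¹ := by
    refine (lintegral_mono_set ?_).trans (lintegral_union_le _ _ _)
    intro ρ hρ
    rcases le_or_gt ρ R with h | h
    · exact .inl ⟨hρ, h⟩
    · exact .inr h
  rw [hint, top_le_iff] at h3
  exact ENNReal.add_ne_top.2 ⟨ne_top_of_le_ne_top h2 h1, hne⟩ h3

/-! ### Bounds for the radial profile -/

lemma radialProfile_le_integratedTail {μ : Measure ℝ} (hμ : μ.map (fun u => -u) = μ) {a K s : ℝ}
    (ha : a ≤ 4 * K) (hs : 0 < s) :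
    radialProfile a μ s ≤
      ENNReal.ofReal (s ^ 2) * (ENNReal.ofReal (2 * K) + 8 * integratedTail μ (1 / s)) := by
  rw [mul_add, radialProfile]
  refine add_le_add ?_ (cosIntegral_le hμ hs)
  rw [← ENNReal.ofReal_mul (by positivity)]
  refine ENNReal.ofReal_le_ofReal ?_
  nlinarith [sq_nonneg s]

lemma integratedTail_le_radialProfile {μ : Measure ℝ} {u₀ s : ℝ} (hμ : IsQuasiUnimodal μ u₀)
    (a : ℝ) (hs : 0 < s) (hsu : u₀ < 1 / s) :
    ENNReal.ofReal (s ^ 2) * integratedTail μ (1 / s) ≤ 8 * radialProfile a μ s :=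
  (integratedTail_le hμ hs hsu).trans (by unfold radialProfile; gcongr; exact le_add_self)

lemma add_eight_mul_le {κ ε g : ℝ≥0∞} (h0 : ε ≠ 0) (ht : ε ≠ ⊤) (h : ε ≤ g) :
    κ + 8 * g ≤ (κ / ε + 8) * g := by
  rw [add_mul]
  gcongr
  calc κ = κ / ε * ε := (ENNReal.div_mul_cancel h0 ht).symm
    _ ≤ _ := by gcongr

lemma UniformSecondMomentBlowup.exists_one_le {ν : Kernel (Euc 2) (Euc 2)} {u₀ : ℝ}
    (h : UniformSecondMomentBlowup ν) (hν : ∀ x, IsQuasiUnimodal (firstMarginal ν x) u₀) :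
    ∃ δ, 0 < δ ∧ ∀ s, 0 < s → s < δ → ∀ x,
      1 / 8 ≤ integratedTail (firstMarginal ν x) (1 / s) := by
  have h1 := eventually_lt_of_lt_liminf (b := 1) (h ▸ ENNReal.one_lt_top)
  obtain ⟨δ, hδ, hsub⟩ := Metric.mem_nhdsWithin_iff.1 h1
  refine ⟨δ, hδ, fun s hs hsδ x => ?_⟩
  have hn := norm_axis hs.le
  have h2 := hsub (show (!₂[s, 0] : Euc 2) ∈ ball 0 δ ∩ {0}ᶜ from
    ⟨by simpa [hn] using hsδ, fun h0 => hs.ne' (by rw [← hn, h0, norm_zero])⟩)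
  have h3 : 1 ≤ ∫⁻ y, ENNReal.ofReal ((1 - Real.cos ⟪(!₂[s, 0] : Euc 2), y⟫_ℝ) /
      ‖(!₂[s, 0] : Euc 2)‖ ^ 2) ∂(ν x) := le_of_lt (h2.trans_le (iInf_le _ x))
  have hs2 : 0 < s ^ 2 := by positivity
  rw [hn] at h3
  simp only [ENNReal.ofReal_div_of_pos hs2] at h3
  simp only [div_eq_mul_inv] at h3
  rw [lintegral_mul_const _ (by fun_prop), ← cosIntegral_firstMarginal, ← div_eq_mul_inv,
    ENNReal.le_div_iff_mul_le (.inl (ENNReal.ofReal_pos.2 hs2).ne') (.inl ENNReal.ofReal_ne_top),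
    one_mul] at h3
  have h4 := h3.trans (cosIntegral_le (hν x).symmetric hs)
  nth_rewrite 1 [← mul_one (ENNReal.ofReal (s ^ 2))] at h4
  rw [ENNReal.mul_le_mul_iff_right (ENNReal.ofReal_pos.2 hs2).ne' ENNReal.ofReal_ne_top] at h4
  rwa [ENNReal.div_le_iff' (by simp) (by simp)]

/-! ### The two equivalences -/

lemma diffusion_nonneg {b : Euc 2 → Euc 2} {c : Euc 2 → ℝ} {ν : Kernel (Euc 2) (Euc 2)}
    (h : IsLevyTriplet b (fun x => c x • (1 : Matrix (Fin 2) (Fin 2) ℝ)) ν) (x : Euc 2) :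
    0 ≤ c x := by
  simpa using (h.posSemidef x).diag_nonneg (i := 0)

lemma diffusion_le {c : Euc 2 → ℝ} {ν : Kernel (Euc 2) (Euc 2)} {K : ℝ} {x : Euc 2}
    (hm : ∫⁻ y, ENNReal.ofReal (min 1 (‖y‖ ^ 2)) ∂(ν x) < ⊤)
    (hK : ∀ ξ, ‖levySymbol (fun _ => 0) (fun x => c x • (1 : Matrix (Fin 2) (Fin 2) ℝ)) ν x ξ‖ ≤
      K * (1 + ‖ξ‖ ^ 2)) : c x ≤ 4 * K := by
  have h1 := (re_le_norm _).trans (hK !₂[1, 0])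
  rw [levySymbol_re c hm, norm_axis zero_le_one] at h1
  have h2 := ENNReal.toReal_nonneg
    (a := ∫⁻ y, ENNReal.ofReal (1 - Real.cos ⟪(!₂[1, 0] : Euc 2), y⟫_ℝ) ∂(ν x))
  linarith

lemma div_add_eight_ne {κ ε : ℝ≥0∞} (hκ : κ ≠ ⊤) (hε : ε ≠ 0) :
    κ / ε + 8 ≠ 0 ∧ κ / ε + 8 ≠ ⊤ :=
  ⟨by simp, ENNReal.add_ne_top.2 ⟨ENNReal.div_ne_top hκ hε, by simp⟩⟩

lemma lt_one_div_of_lt_one_div {s R : ℝ} (hR : 0 < R) (hs : 0 < s) (h : s < 1 / R) :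
    R < 1 / s := by
  rwa [lt_div_iff₀ hs, mul_comm, ← lt_div_iff₀ hR]

/-- The recurrence criterion for a family of profiles `E x` and integrated tails `T x`. If no `T x`
charges anything, the profiles are at most quadratic and both integrals diverge; otherwise the
supremum of the `T x` is bounded away from zero at infinity and absorbs the constant `κ`. -/
lemma exists_lintegral_iSup_eq_top_iff {ι : Type*} {E T : ι → ℝ → ℝ≥0∞} {κ : ℝ≥0∞} {u₀ : ℝ}
    (hκ : κ ≠ ⊤) (hu : 0 < u₀) (hTmono : ∀ x, Monotone (T x))
    (hT0 : ∀ x r ρ, 0 < r → T x r = 0 → T x ρ = 0)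
    (hE : ∀ x t s, 0 ≤ t → t ≤ s → E x t ≤ 4 * E x s)
    (hupper : ∀ x s, 0 < s → E x s ≤ ENNReal.ofReal (s ^ 2) * (κ + 8 * T x (1 / s)))
    (hlower : ∀ x s, 0 < s → u₀ < 1 / s → ENNReal.ofReal (s ^ 2) * T x (1 / s) ≤ 8 * E x s) :
    (∃ r : ℝ, 0 < r ∧ ∫⁻ ξ in ball (0 : Euc 2) r, (⨆ x, E x ‖ξ‖)⁻¹ = ⊤) ↔
      ∃ r : ℝ, 0 < r ∧ ∫⁻ ρ in Ioi r, (ENNReal.ofReal ρ * ⨆ x, T x ρ)⁻¹ = ⊤ := by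
  set H : ℝ → ℝ≥0∞ := fun s => ⨆ x, E x s with hH
  set G : ℝ → ℝ≥0∞ := fun ρ => ⨆ x, T x ρ with hG
  have hGmono : Monotone G := fun _ _ h => iSup_mono fun x => hTmono x h
  have hdouble : ∀ t s, 0 ≤ t → t ≤ s → H t ≤ 4 * H s := fun t s ht hts =>
    iSup_le fun x => (hE x t s ht hts).trans (by gcongr; exact le_iSup (fun x => E x s) x)
  have hHG : ∀ s, 0 < s → H s ≤ ENNReal.ofReal (s ^ 2) * (κ + 8 * G (1 / s)) := fun s hs =>
    iSup_le fun x => (hupper x s hs).trans (by gcongr; exact le_iSup (fun x => T x (1 / s)) x)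
  have hGH : ∀ s, 0 < s → u₀ < 1 / s → ENNReal.ofReal (s ^ 2) * G (1 / s) ≤ 8 * H s := by
    intro s hs hsu
    rw [hG, ENNReal.mul_iSup]
    exact iSup_le fun x => (hlower x s hs hsu).trans
      (by gcongr; exact le_iSup (fun x => E x s) x)
  change (∃ r : ℝ, 0 < r ∧ ∫⁻ ξ in ball (0 : Euc 2) r, (H ‖ξ‖)⁻¹ = ⊤) ↔
    ∃ r : ℝ, 0 < r ∧ ∫⁻ ρ in Ioi r, (ENNReal.ofReal ρ * G ρ)⁻¹ = ⊤
  by_cases hzero : ∃ ρ₀, 0 < ρ₀ ∧ G ρ₀ ≠ 0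
  · obtain ⟨ρ₀, hρ₀, hGρ₀⟩ := hzero
    have hpos : ∀ r, 0 < r → G r ≠ 0 := by
      intro r hr h0
      refine hGρ₀ (ENNReal.iSup_eq_zero.2 fun x => ?_)
      exact hT0 x r ρ₀ hr (ENNReal.iSup_eq_zero.1 h0 x)
    -- The minimum with `1` keeps `ε` finite when `G ρ₀` is infinite.
    set ε := min (G ρ₀) 1 with hε
    have hε0 : ε ≠ 0 := (lt_min (pos_iff_ne_zero.2 hGρ₀) zero_lt_one).ne'
    have hεt : ε ≠ ⊤ := ne_top_of_le_ne_top ENNReal.one_ne_top (min_le_right _ _)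
    obtain ⟨hC0, hC⟩ := div_add_eight_ne hκ hε0
    set R := max u₀ ρ₀ with hR
    have hR0 : 0 < R := lt_max_of_lt_left hu
    have hup : ∀ s, 0 < s → s < 1 / R →
        H s ≤ (κ / ε + 8) * (ENNReal.ofReal (s ^ 2) * G (1 / s)) := by
      intro s hs hsR
      have h1 : ε ≤ G (1 / s) := (min_le_left _ _).trans
        (hGmono ((le_max_right _ _).trans (lt_one_div_of_lt_one_div hR0 hs hsR).le))
      calc H s ≤ ENNReal.ofReal (s ^ 2) * (κ + 8 * G (1 / s)) := hHG s hs
        _ ≤ ENNReal.ofReal (s ^ 2) * ((κ / ε + 8) * G (1 / s)) := by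
          gcongr
          exact add_eight_mul_le hε0 hεt h1
        _ = _ := mul_left_comm _ _ _
    have hlow : ∀ s, 0 < s → s < 1 / R →
        ENNReal.ofReal (s ^ 2) * G (1 / s) ≤ 8 * H s := fun s hs hsR =>
      hGH s hs ((le_max_left _ _).trans_lt (lt_one_div_of_lt_one_div hR0 hs hsR))
    have hδ : 0 < 1 / R := by positivity
    constructor
    · rintro ⟨r, hr, hint⟩
      refine ⟨1 / (1 / R), by positivity, ?_⟩
      refine lintegral_Ioi_eq_top hGmono (by simp) (by simp) hδ hlow ?_
      refine lintegral_ball_eq_top_of_le hdouble hδ ?_ hint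
      intro h0
      have h1 := hlow (1 / R / 2) (by positivity) (by linarith)
      rw [h0, mul_zero, nonpos_iff_eq_zero, mul_eq_zero, ENNReal.ofReal_eq_zero] at h1
      rcases h1 with h1 | h1
      · have : 0 < (1 / R / 2) ^ 2 := by positivity
        linarith
      · exact hpos _ (by positivity) h1
    · rintro ⟨r, hr, hint⟩
      exact ⟨1 / R, hδ, lintegral_ball_eq_top hGmono hC0 hC hδ hup
        (lintegral_Ioi_eq_top_of_pos hGmono hr (hpos r hr) hint)⟩
  · -- All tails vanish: the profiles are at most `κ s ^ 2`, and both integrals diverge.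
    push Not at hzero
    refine iff_of_true ⟨1, one_pos, ?_⟩ ⟨1, one_pos, ?_⟩
    · refine lintegral_ball_eq_top (G := fun _ => 1) monotone_const (C := κ + 1) (by simp)
        (ENNReal.add_ne_top.2 ⟨hκ, ENNReal.one_ne_top⟩) one_pos (fun s hs _ => ?_) ?_
      · refine (hHG s hs).trans ?_
        rw [hzero _ (by positivity), mul_zero, add_zero, mul_one, mul_comm]
        gcongr
        exact le_self_add
      · simpa using lintegral_Ioi_inv_eq_top
    · rw [setLIntegral_congr_fun measurableSet_Ioi (g := fun _ => ⊤)]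
      · simp
      · intro ρ hρ
        simp [hzero ρ (zero_lt_one.trans hρ)]

/-- The transience criterion for a family of profiles `E x` and integrated tails `T x` that are
bounded away from zero at infinity, uniformly in `x`. -/
lemma exists_lintegral_iInf_lt_top_iff {ι : Type*} {E T : ι → ℝ → ℝ≥0∞} {κ : ℝ≥0∞} {u₀ δ₁ : ℝ}
    (hκ : κ ≠ ⊤) (hu : 0 < u₀) (hTmono : ∀ x, Monotone (T x)) (hδ₁ : 0 < δ₁)
    (hone : ∀ s, 0 < s → s < δ₁ → ∀ x, 1 / 8 ≤ T x (1 / s))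
    (hupper : ∀ x s, 0 < s → E x s ≤ ENNReal.ofReal (s ^ 2) * (κ + 8 * T x (1 / s)))
    (hlower : ∀ x s, 0 < s → u₀ < 1 / s → ENNReal.ofReal (s ^ 2) * T x (1 / s) ≤ 8 * E x s) :
    (∃ r : ℝ, 0 < r ∧ ∫⁻ ξ in ball (0 : Euc 2) r, (⨅ x, E x ‖ξ‖)⁻¹ < ⊤) ↔
      ∃ r : ℝ, 0 < r ∧ ∫⁻ ρ in Ioi r, (ENNReal.ofReal ρ * ⨅ x, T x ρ)⁻¹ < ⊤ := by
  set H : ℝ → ℝ≥0∞ := fun s => ⨅ x, E x s with hH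
  set G : ℝ → ℝ≥0∞ := fun ρ => ⨅ x, T x ρ with hG
  have hGmono : Monotone G := fun _ _ h => iInf_mono fun x => hTmono x h
  obtain ⟨hC0, hC⟩ := div_add_eight_ne hκ (ε := 1 / 8) (by simp)
  set δ := min δ₁ (1 / u₀) with hδdef
  have hδ : 0 < δ := lt_min hδ₁ (by positivity)
  have hup : ∀ s, 0 < s → s < δ →
      H s ≤ (κ / (1 / 8) + 8) * (ENNReal.ofReal (s ^ 2) * G (1 / s)) := by
    intro s hs hsδ
    rw [mul_left_comm]
    refine (le_iInf fun x => ?_ : H s ≤ ⨅ x, ENNReal.ofReal (s ^ 2) *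
      ((κ / (1 / 8) + 8) * T x (1 / s))).trans_eq ?_
    · calc H s ≤ E x s := iInf_le _ x
        _ ≤ ENNReal.ofReal (s ^ 2) * (κ + 8 * T x (1 / s)) := hupper x s hs
        _ ≤ _ := by
          gcongr
          exact add_eight_mul_le (by simp) (by simp)
            (hone s hs (hsδ.trans_le (min_le_left _ _)) x)
    · have hs2 : 0 < s ^ 2 := by positivity
      rw [← ENNReal.mul_iInf_of_ne (ENNReal.ofReal_pos.2 hs2).ne' ENNReal.ofReal_ne_top,
        ← ENNReal.mul_iInf_of_ne hC0 hC]
  have hlow : ∀ s, 0 < s → s < δ → ENNReal.ofReal (s ^ 2) * G (1 / s) ≤ 8 * H s := by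
    intro s hs hsδ
    change _ ≤ 8 * ⨅ x, E x s
    rw [ENNReal.mul_iInf_of_ne (a := 8) (by simp) (by simp)]
    refine le_iInf fun x => le_trans ?_
      (hlower x s hs (lt_one_div_of_lt_one_div hu hs (hsδ.trans_le (min_le_right _ _))))
    gcongr
    exact iInf_le (fun x => T x (1 / s)) x
  constructor
  · rintro ⟨r, hr, hint⟩
    have hr' : 0 < min r δ := lt_min hr hδ
    refine ⟨1 / min r δ, by positivity, lt_top_iff_ne_top.2 fun htop => ?_⟩
    have h1 := lintegral_ball_eq_top hGmono hC0 hC hr'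
      (fun s hs hsr => hup s hs (hsr.trans_le (min_le_right _ _))) htop
    have h2 := lintegral_mono_set (μ := volume) (f := fun ξ : Euc 2 => (H ‖ξ‖)⁻¹)
      (ball_subset_ball (x := (0 : Euc 2)) (min_le_left r δ))
    rw [h1] at h2
    exact (h2.trans_lt hint).ne rfl
  · rintro ⟨r, hr, hint⟩
    have hr' : 0 < min (1 / r) δ := lt_min (by positivity) hδ
    refine ⟨min (1 / r) δ, hr', lt_top_iff_ne_top.2 fun htop => ?_⟩
    have h1 := lintegral_Ioi_eq_top hGmono (by simp) (by simp) hr'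
      (fun s hs hsr => hlow s hs (hsr.trans_le (min_le_right _ _))) htop
    have hle : r ≤ 1 / min (1 / r) δ := by
      rw [le_div_iff₀ hr', mul_comm, ← le_div_iff₀ hr]
      exact min_le_left _ _
    have h2 := lintegral_mono_set (μ := volume)
      (f := fun ρ : ℝ => (ENNReal.ofReal ρ * G ρ)⁻¹) (Ioi_subset_Ioi hle)
    rw [h1] at h2
    exact (h2.trans_lt hint).ne rfl

theorem theorem4p3 {Ω : Type*} [MeasurableSpace Ω] (F : MarkovProcess 2 Ω)
    (c : Euc 2 → ℝ) (ν : Kernel (Euc 2) (Euc 2))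
    (hF : IsLevyTypeProcess F (fun _ => 0)
      (fun x => c x • (1 : Matrix (Fin 2) (Fin 2) ℝ)) ν)
    (q : Euc 2 → Euc 2 → ℂ)
    (hq : q = levySymbol (fun _ => 0) (fun x => c x • (1 : Matrix (Fin 2) (Fin 2) ℝ)) ν)
    (hradial : ∀ x, IsRadial (q x))
    (u₀ : ℝ) (hu₀ : 1 < u₀)
    (hquasi : ∀ x, IsQuasiUnimodal (firstMarginal ν x) u₀) :
    (ChungFuchsRecurrence q ↔ TailDivergence ν) ∧
      (UniformSecondMomentBlowup ν → (ChungFuchsTransience q ↔ TailConvergence ν)) := by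
  subst hq
  have hu : 0 < u₀ := zero_lt_one.trans hu₀
  have hm := hF.triplet.integrable
  have hc := diffusion_nonneg hF.triplet
  obtain ⟨K, hK⟩ := hF.bounded
  have hTmono : ∀ x, Monotone (integratedTail (firstMarginal ν x)) := fun x =>
    integratedTail_mono _
  have hupper : ∀ x s, 0 < s → radialProfile (c x) (firstMarginal ν x) s ≤
      ENNReal.ofReal (s ^ 2) *
        (ENNReal.ofReal (2 * K) + 8 * integratedTail (firstMarginal ν x) (1 / s)) :=
    fun x s hs => radialProfile_le_integratedTail (hquasi x).symmetric
      (diffusion_le (hm x) (hK x)) hs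
  have hlower : ∀ x s, 0 < s → u₀ < 1 / s →
      ENNReal.ofReal (s ^ 2) * integratedTail (firstMarginal ν x) (1 / s) ≤
        8 * radialProfile (c x) (firstMarginal ν x) s :=
    fun x s hs hsu => integratedTail_le_radialProfile (hquasi x) _ hs hsu
  constructor
  · simp only [ChungFuchsRecurrence, TailDivergence, truncN_eq_integratedTail,
      fun x ξ => enorm_levySymbol (hm x) (hc x) (hradial x) ξ]
    exact exists_lintegral_iSup_eq_top_iff ENNReal.ofReal_ne_top hu hTmono
      (fun x r ρ hr h => integratedTail_eq_zero hr h ρ)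
      (fun x t s => radialProfile_le (hm x) (hc x) (hradial x)) hupper hlower
  · intro hblow
    obtain ⟨δ, hδ, hone⟩ := hblow.exists_one_le hquasi
    simp only [ChungFuchsTransience, TailConvergence, truncN_eq_integratedTail,
      fun x ξ => ofReal_levySymbol_re_eq_radialProfile (hm x) (hc x) (hradial x) ξ]
    exact exists_lintegral_iInf_lt_top_iff ENNReal.ofReal_ne_top hu hTmono hδ hone hupper hlower
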